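/- Let $\mathcal E$ be the ring of germs at the origin of smooth ($C^\infty$) functions of two real variables $(x,\lambda)$. Let $\prec$ be a local order, i.e. a strict total order on the monomials $x^i\lambda^j$ such that $u\prec v$ implies $uw\prec vw$ for all monomials $u,v,w$, and such that $x\prec 1$ and $\lambda\prec 1$. For $f\in\mathcal E$ with Taylor series $\sum a_{ij}x^i\lambda^j$ at the origin, let $\mathrm{Terms}(f)=\{a_{ij}x^i\lambda^j : a_{ij}\ne 0\}$. The germ $f$ is called flat if $\mathrm{Terms}(f)=\emptyset$. The leading term $LT(f)$ is the term of $f$ with the $\prec$-largest monomial, and $LT(f)=0$ if $f$ is flat; the leading coefficient $LC(f)$ is the coefficient of $LT(f)$. Divisibility is in $\mathcal E$. A finite family $g_1,\dots,g_m$ is a standard basis of the ideal $I$ it generates if the ideal $\langle LT(h) : h\in I\rangle$ of $\mathcal E$ equals $\langle LT(g_1),\dots,LT(g_m)\rangle$. Theorem. Let $I=\langle f_1,\dots,f_n\rangle$ be the ideal of $\mathcal E$ generated by germs $f_1,\dots,f_n$. (1) There are $m\le n$ and germs $g_1,\dots,g_m\in\mathcal E$ with $I=\langle g_1,\dots,g_m\rangle$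 such that, for all $i,j$, $LT(g_i)$ divides no $p\in\mathrm{Terms}(g_j)$, except when $i=j$ and $p=LT(g_i)$. (2) If $f_1,\dots,f_n$ is a standard basis of $I$, then there are $m\le n$ and a reduced standard basis $g_1,\dots,g_m$ of $I$, that is, a standard basis of $I$ which satisfies the divisibility condition in (1) and for which $LC(g_i)=1$ for every $g_i$ that is not flat. Moreover, it can be chosen so that no flat $g_j$ lies in the ideal generated by the other $g_i$. -/

import Mathlib

open Filter Topology
open scoped ContDiff

noncomputable section

/-- The ring `𝓔` of smooth real-valued germs at the origin of the `(x, l)`-plane: the germs that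
have a representative which is `C^∞` on a neighbourhood of the origin. (Being `C^∞` at all points
near the origin is required, as `ContDiffAt ℝ ∞ f 0` alone would let the neighbourhood shrink with
the order of differentiation.) -/
def smoothGermRing : Subring (Germ (𝓝 (0 : ℝ × ℝ)) ℝ) where
  carrier := {φ | ∃ f : ℝ × ℝ → ℝ, φ = ↑f ∧ ∀ᶠ p in 𝓝 (0 : ℝ × ℝ), ContDiffAt ℝ ∞ f p}
  mul_mem' := by
    rintro _ _ ⟨f, rfl, hf⟩ ⟨g, rfl, hg⟩
    exact ⟨f * g, rfl, by filter_upwards [hf, hg] with p h1 h2 using h1.mul h2⟩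
  one_mem' := ⟨1, rfl, Eventually.of_forall fun _ => contDiffAt_const⟩
  add_mem' := by
    rintro _ _ ⟨f, rfl, hf⟩ ⟨g, rfl, hg⟩
    exact ⟨f + g, rfl, by filter_upwards [hf, hg] with p h1 h2 using h1.add h2⟩
  zero_mem' := ⟨0, rfl, Eventually.of_forall fun _ => contDiffAt_const⟩
  neg_mem' := by
    rintro _ ⟨f, rfl, hf⟩
    exact ⟨-f, rfl, by filter_upwards [hf] with p h1 using h1.neg⟩

/-- The type of smooth germs `𝓔`, a commutative ring. -/
abbrev SmoothGerm : Type := smoothGermRing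

/-- The partial derivative in the first variable `x`. -/
def partialX (f : ℝ × ℝ → ℝ) : ℝ × ℝ → ℝ := fun p => fderiv ℝ f p (1, 0)

/-- The partial derivative in the second variable `l`. -/
def partialL (f : ℝ × ℝ → ℝ) : ℝ × ℝ → ℝ := fun p => fderiv ℝ f p (0, 1)

theorem partialX_iterate_congr {f g : ℝ × ℝ → ℝ} {a : ℝ × ℝ} (h : f =ᶠ[𝓝 a] g) (n : ℕ) :
    partialX^[n] f =ᶠ[𝓝 a] partialX^[n] g := by
  induction n with
  | zero => exact h
  | succ n ih =>
    rw [Function.iterate_succ_apply', Function.iterate_succ_apply']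
    filter_upwards [ih.fderiv (𝕜 := ℝ)] with p hp
    simp [partialX, hp]

theorem partialL_iterate_congr {f g : ℝ × ℝ → ℝ} {a : ℝ × ℝ} (h : f =ᶠ[𝓝 a] g) (n : ℕ) :
    partialL^[n] f =ᶠ[𝓝 a] partialL^[n] g := by
  induction n with
  | zero => exact h
  | succ n ih =>
    rw [Function.iterate_succ_apply', Function.iterate_succ_apply']
    filter_upwards [ih.fderiv (𝕜 := ℝ)] with p hp
    simp [partialL, hp]

/-- A local order: a strict total order `≺` on the monomials `x^i l^j`, given through their
exponents `(i, j)`, that is compatible with multiplication and satisfies `x ≺ 1` and `l ≺ 1`. -/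
structure LocalOrder where
  /-- `lt α β` means `X^α ≺ X^β`. -/
  lt : ℕ × ℕ → ℕ × ℕ → Prop
  irrefl : ∀ α, ¬ lt α α
  trans : ∀ α β γ, lt α β → lt β γ → lt α γ
  total : ∀ α β, lt α β ∨ α = β ∨ lt β α
  add_right : ∀ α β γ, lt α β → lt (α + γ) (β + γ)
  x_lt_one : lt (1, 0) (0, 0)
  l_lt_one : lt (0, 1) (0, 0)

/-- Multiplying a monomial by a nontrivial one makes it smaller. -/
theorem LocalOrder.lt_of_lt (ord : LocalOrder) {α β : ℕ × ℕ} (h : α < β) : ord.lt β α := by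
  have key : ∀ γ : ℕ × ℕ, γ = 0 ∨ ord.lt γ 0 := by
    have hx : ∀ i : ℕ, (i, 0) = (0 : ℕ × ℕ) ∨ ord.lt (i, 0) 0 := by
      intro i
      induction i with
      | zero => exact Or.inl rfl
      | succ i ih =>
        have h1 := ord.add_right _ _ (i, 0) ord.x_lt_one
        simp only [Prod.mk_add_mk, zero_add, add_zero, add_comm 1 i] at h1
        rcases ih with h0 | h0
        · rw [h0] at h1; exact Or.inr h1
        · exact Or.inr (ord.trans _ _ _ h1 h0)
    rintro ⟨i, j⟩
    induction j with
    | zero => exact hx i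
    | succ j ih =>
      have h1 := ord.add_right _ _ (i, j) ord.l_lt_one
      simp only [Prod.mk_add_mk, zero_add, add_comm 1 j] at h1
      rcases ih with h0 | h0
      · rw [h0] at h1; exact Or.inr h1
      · exact Or.inr (ord.trans _ _ _ h1 h0)
  obtain ⟨γ, rfl⟩ := exists_add_of_le h.le
  rcases key γ with h0 | h0
  · subst h0; simp at h
  · have := ord.add_right _ _ α h0
    rwa [zero_add, add_comm] at this

/-- Every nonempty set of monomials has a maximum with respect to a local order. -/
theorem LocalOrder.exists_max (ord : LocalOrder) {S : Set (ℕ × ℕ)} (hS : S.Nonempty) :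
    ∃ α ∈ S, ∀ β ∈ S, β ≠ α → ord.lt β α := by
  have hwf : WellFounded (fun α β => ord.lt β α) := by
    have : IsStrictOrder (ℕ × ℕ) (fun α β => ord.lt β α) :=
      { irrefl := ord.irrefl
        trans := fun a b c h1 h2 => ord.trans _ _ _ h2 h1 }
    rw [RelEmbedding.wellFounded_iff_isEmpty]
    constructor
    intro u
    obtain ⟨m, n, hmn, hle⟩ := wellQuasiOrdered_le (α := ℕ × ℕ) u
    have h1 : ord.lt (u m) (u n) := u.map_rel_iff.2 hmn
    rcases hle.eq_or_lt with h | h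
    · rw [h] at h1; exact ord.irrefl _ h1
    · exact ord.irrefl _ (ord.trans _ _ _ h1 (ord.lt_of_lt h))
  obtain ⟨α, hα, hmax⟩ := hwf.has_min S hS
  refine ⟨α, hα, fun β hβ hne => ?_⟩
  rcases ord.total β α with h | h | h
  · exact h
  · exact absurd h hne
  · exact absurd h (hmax β hβ)

namespace SmoothGerm

/-- The Taylor coefficient of `x^i l^j` of a smooth germ at the origin, for `α = (i, j)`. -/
def taylorCoeff (φ : SmoothGerm) (α : ℕ × ℕ) : ℝ :=
  Germ.liftOn φ.1 (fun f => partialX^[α.1] (partialL^[α.2] f) 0 / (Nat.factorial α.1 * Nat.factorial α.2))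
    (fun _ _ h => by
      have := (partialX_iterate_congr (partialL_iterate_congr h α.2) α.1).eq_of_nhds
      simp only [this])

/-- The term `c x^i l^j` as a smooth germ, for `α = (i, j)`. -/
def term (c : ℝ) (α : ℕ × ℕ) : SmoothGerm :=
  ⟨↑(fun p : ℝ × ℝ => c * (p.1 ^ α.1 * p.2 ^ α.2)), _, rfl, Eventually.of_forall fun _ =>
    ContDiff.contDiffAt (by fun_prop)⟩

/-- The exponents of the monomials that occur in the Taylor series of `φ`. -/
def support (φ : SmoothGerm) : Set (ℕ × ℕ) := {α | taylorCoeff φ α ≠ 0}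

/-- A germ is flat when its Taylor series at the origin vanishes. -/
def IsFlat (φ : SmoothGerm) : Prop := ∀ α, taylorCoeff φ α = 0

/-- The set of terms that occur in the Taylor series of `φ`. -/
def terms (φ : SmoothGerm) : Set SmoothGerm := {p | ∃ α ∈ support φ, p = term (taylorCoeff φ α) α}

open Classical in
/-- The exponent of the leading monomial of a germ that is not flat (`0` for a flat germ). -/
def leadExp (ord : LocalOrder) (φ : SmoothGerm) : ℕ × ℕ :=
  if h : (support φ).Nonempty then (ord.exists_max h).choose else 0

/-- The leading coefficient of `φ` (which is `0` when `φ` is flat). -/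
def leadCoeff (ord : LocalOrder) (φ : SmoothGerm) : ℝ := taylorCoeff φ (leadExp ord φ)

/-- The leading term of `φ`: its largest term, and `0` when `φ` is flat. -/
def leadTerm (ord : LocalOrder) (φ : SmoothGerm) : SmoothGerm :=
  term (leadCoeff ord φ) (leadExp ord φ)

/-- The leading term ideal of an ideal of `𝓔`. -/
def leadTermIdeal (ord : LocalOrder) (I : Ideal SmoothGerm) : Ideal SmoothGerm :=
  Ideal.span {p | ∃ φ ∈ I, p = leadTerm ord φ}

/-- `g₁, …, gₘ` generate `I`, and their leading terms generate the leading term ideal of `I`. -/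
def IsStandardBasis (ord : LocalOrder) {m : ℕ} (g : Fin m → SmoothGerm)
    (I : Ideal SmoothGerm) : Prop :=
  Ideal.span (Set.range g) = I ∧
    leadTermIdeal ord I = Ideal.span (Set.range fun i => leadTerm ord (g i))

/-- No leading term `LT(gᵢ)` divides a term of some `gⱼ`, apart from `LT(gᵢ)` as a term of `gᵢ`. -/
def LeadTermsDivideNoTerms (ord : LocalOrder) {m : ℕ} (g : Fin m → SmoothGerm) : Prop :=
  ∀ i j, ∀ p ∈ terms (g j), ¬ (i = j ∧ p = leadTerm ord (g i)) → ¬ leadTerm ord (g i) ∣ p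

/-- A reduced standard basis of `I`. The leading coefficient is normalized to `1` for the members
that are not flat; a flat member has no terms and hence no leading coefficient to normalize. -/
def IsReducedStandardBasis (ord : LocalOrder) {m : ℕ} (g : Fin m → SmoothGerm)
    (I : Ideal SmoothGerm) : Prop :=
  IsStandardBasis ord g I ∧ (∀ i, ¬ IsFlat (g i) → leadCoeff ord (g i) = 1) ∧
    LeadTermsDivideNoTerms ord g

end SmoothGerm

end

/-!
By Borel's theorem the Taylor series map is a surjective ring homomorphism from `𝓔` onto the formal
power series. Every set of monomials has a maximum for `≺`, so formal power series can be divided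
with remainder by recursion on exponents, from the largest down, and this division lifts to germs.

If the leading monomial of one generator divides that of another, replacing the latter by its
remainder modulo the other generators either enlarges the set of monomials that are divisible by
some leading monomial, or turns the generator into a flat germ. By Dickson's lemma this can only
happen finitely often. Once the leading monomials are pairwise indivisible, dividing what follows
the leading term of a generator by all generators, including itself, clears its reducible terms:
the generator is used only with a quotient that vanishes at the origin, so it gets multiplied by a
unit, and the ideal and all leading monomials stay the same.

No step loses a monomial that is divisible by a leading monomial, so a standard basis remains
one; flat members contribute nothing to the leading terms, so the redundant ones can be left out.
-/

section SmoothSeries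

variable {E F : Type*} [NormedAddCommGroup E] [NormedSpace ℝ E] [NormedAddCommGroup F]
  [NormedSpace ℝ F] {ι : Type*}

/-- A family of smooth functions, every derivative of which is summable uniformly over the space:
the hypothesis under which its sum is smooth and can be differentiated term by term. -/
structure SmoothlySummable (f : ι → E → F) : Prop where
  contDiff : ∀ a, ContDiff ℝ ∞ (f a)
  exists_bound : ∀ k : ℕ, ∃ u : ι → ℝ, Summable u ∧ ∀ a p, ‖iteratedFDeriv ℝ k (f a) p‖ ≤ u a

namespace SmoothlySummable

theorem of_eventually_le {f : ι → E → F} {u : ι → ℝ} (hf : ∀ a, ContDiff ℝ ∞ (f a))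
    (hbdd : ∀ a k, ∃ C : ℝ, ∀ p, ‖iteratedFDeriv ℝ k (f a) p‖ ≤ C) (hu : Summable u)
    (hle : ∀ k, ∀ᶠ a in cofinite, ∀ p, ‖iteratedFDeriv ℝ k (f a) p‖ ≤ u a) :
    SmoothlySummable f where
  contDiff := hf
  exists_bound k := by
    classical
    choose C hC using fun a => hbdd a k
    refine ⟨fun a => if ∀ p, ‖iteratedFDeriv ℝ k (f a) p‖ ≤ u a then u a else C a,
      hu.congr_cofinite ?_, fun a p => ?_⟩
    · filter_upwards [hle k] with a ha using (if_pos ha).symm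
    · dsimp only
      split_ifs with h
      exacts [h p, hC a p]

variable {f : ι → E → F} (hf : SmoothlySummable f)

include hf

theorem contDiff_tsum [CompleteSpace F] : ContDiff ℝ ∞ fun p => ∑' a, f a p := by
  choose u hu hle using hf.exists_bound
  exact _root_.contDiff_tsum (N := ⊤) hf.contDiff (fun k _ => hu k) fun k a p _ => hle k a p

theorem fderiv_apply (v : E) : SmoothlySummable fun a p => fderiv ℝ (f a) p v where
  contDiff a := ((hf.contDiff a).fderiv_right (by simp)).clm_apply contDiff_const
  exists_bound k := by
    obtain ⟨u, hu, hle⟩ := hf.exists_bound (k + 1)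
    refine ⟨fun a => ‖v‖ * u a, hu.mul_left _, fun a p => ?_⟩
    calc ‖iteratedFDeriv ℝ k (fun p => fderiv ℝ (f a) p v) p‖
        ≤ ‖v‖ * ‖iteratedFDeriv ℝ k (fderiv ℝ (f a)) p‖ :=
          norm_iteratedFDeriv_clm_apply_const (N := ∞)
            ((hf.contDiff a).fderiv_right (by simp)).contDiffAt (by exact_mod_cast le_top)
      _ ≤ ‖v‖ * u a := by
          rw [norm_iteratedFDeriv_fderiv]
          exact mul_le_mul_of_nonneg_left (hle a p) (norm_nonneg v)

theorem fderiv_tsum_apply [CompleteSpace F] (v p : E) :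
    fderiv ℝ (fun q => ∑' a, f a q) p v = ∑' a, fderiv ℝ (f a) p v := by
  obtain ⟨u₀, hu₀, hle₀⟩ := hf.exists_bound 0
  obtain ⟨u₁, hu₁, hle₁⟩ := hf.exists_bound 1
  have hfderiv : ∀ a q, ‖fderiv ℝ (f a) q‖ ≤ u₁ a := fun a q => by
    simpa only [norm_iteratedFDeriv_one] using hle₁ a q
  have hvalue : Summable fun a => f a p := hu₀.of_norm_bounded fun a => by
    simpa only [norm_iteratedFDeriv_zero] using hle₀ a p
  rw [_root_.fderiv_tsum_apply hu₁ (fun a => (hf.contDiff a).differentiable (by simp)) hfderiv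
    hvalue p]
  exact (hu₁.of_norm_bounded fun a => hfderiv a p).hasSum.mapL
    (ContinuousLinearMap.apply ℝ F v) |>.tsum_eq.symm

end SmoothlySummable

theorem SmoothlySummable.partialX_partialL_tsum {f : ι → ℝ × ℝ → ℝ} (hf : SmoothlySummable f)
    (i j : ℕ) :
    partialX^[i] (partialL^[j] fun p => ∑' a, f a p) =
      fun p => ∑' a, partialX^[i] (partialL^[j] (f a)) p := by
  have iterate_partialL : ∀ j, SmoothlySummable (fun a => partialL^[j] (f a)) ∧
      partialL^[j] (fun p => ∑' a, f a p) = fun p => ∑' a, partialL^[j] (f a) p := fun j => by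
    induction j with
    | zero => exact ⟨hf, rfl⟩
    | succ j ih =>
      simp only [Function.iterate_succ_apply', ih.2]
      exact ⟨ih.1.fderiv_apply _, funext fun p => ih.1.fderiv_tsum_apply _ p⟩
  suffices SmoothlySummable (fun a => partialX^[i] (partialL^[j] (f a))) ∧
      partialX^[i] (partialL^[j] fun p => ∑' a, f a p) =
        fun p => ∑' a, partialX^[i] (partialL^[j] (f a)) p from this.2
  induction i with
  | zero => exact iterate_partialL j
  | succ i ih =>
    simp only [Function.iterate_succ_apply', ih.2]
    exact ⟨ih.1.fderiv_apply _, funext fun p => ih.1.fderiv_tsum_apply _ p⟩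

theorem exists_norm_iteratedFDeriv_le {f : E → F} (hf : ContDiff ℝ ∞ f)
    (hsupp : HasCompactSupport f) (k : ℕ) : ∃ C : ℝ, ∀ p, ‖iteratedFDeriv ℝ k f p‖ ≤ C :=
  (hsupp.iteratedFDeriv k).exists_bound_of_continuous
    (hf.continuous_iteratedFDeriv (by exact_mod_cast le_top))

theorem iteratedFDeriv_const_smul_comp_smul {f : E → F} (hf : ContDiff ℝ ∞ f) (c t : ℝ) (k : ℕ)
    (p : E) :
    iteratedFDeriv ℝ k (fun p => c • f (t • p)) p =
      (c * t ^ k) • iteratedFDeriv ℝ k f (t • p) := by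
  have hk : ContDiff ℝ k f := hf.of_le (by exact_mod_cast le_top)
  have hcomp : ContDiff ℝ k fun p => f (t • p) := hk.comp (contDiff_const_smul t)
  rw [iteratedFDeriv_const_smul_apply' hcomp.contDiffAt, iteratedFDeriv_comp_const_smul _ hk,
    smul_smul]

theorem exists_dilation_iteratedFDeriv_le {f : E → F} (hf : ContDiff ℝ ∞ f)
    (hbdd : ∀ k, ∃ C : ℝ, ∀ p, ‖iteratedFDeriv ℝ k f p‖ ≤ C) (c : ℝ) (d : ℕ) {ε : ℝ}
    (hε : 0 < ε) :
    ∃ t : ℝ, t ≠ 0 ∧ ∀ k < d, ∀ p,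
      ‖iteratedFDeriv ℝ k (fun p => (c * t⁻¹ ^ d) • f (t • p)) p‖ ≤ ε := by
  choose C hC using hbdd
  have hsmall : ∀ k < d, ∀ᶠ t : ℝ in atTop, ‖c * t⁻¹ ^ d * t ^ k‖ * C k < ε := fun k hk => by
    have hpow : (fun t : ℝ => t⁻¹ ^ (d - k)) =ᶠ[atTop] fun t => t⁻¹ ^ d * t ^ k := by
      filter_upwards [eventually_ne_atTop 0] with t ht
      rw [pow_sub₀ _ (inv_ne_zero ht) hk.le, inv_pow t k, inv_inv]
    have hlim : Tendsto (fun t : ℝ => t⁻¹ ^ d * t ^ k) atTop (𝓝 0) := by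
      simpa only [zero_pow (Nat.sub_ne_zero_of_lt hk)] using
        (tendsto_inv_atTop_zero.pow (d - k)).congr' hpow
    have := ((hlim.const_mul c).norm.mul_const (C k))
    simp only [mul_zero, norm_zero, zero_mul, ← mul_assoc] at this
    exact this.eventually_lt_const hε
  obtain ⟨t, ht, hle⟩ := ((eventually_ne_atTop 0).and
    ((Set.finite_Iio d).eventually_all.2 hsmall)).exists
  refine ⟨t, ht, fun k hk p => ?_⟩
  rw [iteratedFDeriv_const_smul_comp_smul hf, norm_smul]
  exact (mul_le_mul_of_nonneg_left (hC k _) (norm_nonneg _)).trans (hle k hk).le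

end SmoothSeries

section Monomials

theorem partialX_const_mul_monomial (c : ℝ) (a b : ℕ) :
    partialX (fun p => c * (p.1 ^ a * p.2 ^ b)) =
      fun p => (c * a) * (p.1 ^ (a - 1) * p.2 ^ b) := by
  funext p
  have h : HasFDerivAt (fun p : ℝ × ℝ => c * (p.1 ^ a * p.2 ^ b)) _ p :=
    (((hasFDerivAt_fst (𝕜 := ℝ)).pow a).mul ((hasFDerivAt_snd (𝕜 := ℝ)).pow b)).const_mul c
  rw [partialX, h.fderiv]
  simp only [nsmul_eq_mul, smul_add, add_apply, smul_apply, ContinuousLinearMap.coe_snd',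
    smul_eq_mul, mul_zero, ContinuousLinearMap.coe_fst', mul_one, zero_add]
  ring

theorem partialL_const_mul_monomial (c : ℝ) (a b : ℕ) :
    partialL (fun p => c * (p.1 ^ a * p.2 ^ b)) =
      fun p => (c * b) * (p.1 ^ a * p.2 ^ (b - 1)) := by
  funext p
  have h : HasFDerivAt (fun p : ℝ × ℝ => c * (p.1 ^ a * p.2 ^ b)) _ p :=
    (((hasFDerivAt_fst (𝕜 := ℝ)).pow a).mul ((hasFDerivAt_snd (𝕜 := ℝ)).pow b)).const_mul c
  rw [partialL, h.fderiv]
  simp only [nsmul_eq_mul, smul_add, add_apply, smul_apply, ContinuousLinearMap.coe_snd',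
    smul_eq_mul, mul_one, ContinuousLinearMap.coe_fst', mul_zero, add_zero]
  ring

theorem iterate_partialX_const_mul_monomial (c : ℝ) (a b i : ℕ) :
    partialX^[i] (fun p => c * (p.1 ^ a * p.2 ^ b)) =
      fun p => (c * a.descFactorial i) * (p.1 ^ (a - i) * p.2 ^ b) := by
  induction i with
  | zero => simp
  | succ i ih =>
    rw [Function.iterate_succ_apply', ih, partialX_const_mul_monomial, Nat.descFactorial_succ,
      Nat.sub_sub, mul_assoc c, mul_comm (a.descFactorial i : ℝ), Nat.cast_mul]

theorem iterate_partialL_const_mul_monomial (c : ℝ) (a b j : ℕ) :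
    partialL^[j] (fun p => c * (p.1 ^ a * p.2 ^ b)) =
      fun p => (c * b.descFactorial j) * (p.1 ^ a * p.2 ^ (b - j)) := by
  induction j with
  | zero => simp
  | succ j ih =>
    rw [Function.iterate_succ_apply', ih, partialL_const_mul_monomial, Nat.descFactorial_succ,
      Nat.sub_sub, mul_assoc c, mul_comm (b.descFactorial j : ℝ), Nat.cast_mul]

theorem descFactorial_mul_zero_pow {R : Type*} [Semiring R] (a i : ℕ) :
    (a.descFactorial i : R) * 0 ^ (a - i) = if i = a then (i.factorial : R) else 0 := by
  rcases lt_trichotomy i a with h | rfl | h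
  · rw [zero_pow (Nat.sub_ne_zero_of_lt h), mul_zero, if_neg h.ne]
  · simp [Nat.descFactorial_self]
  · simp [Nat.descFactorial_of_lt h, h.ne']

theorem partialX_partialL_const_mul_monomial_zero (c : ℝ) (α β : ℕ × ℕ) :
    partialX^[β.1] (partialL^[β.2] fun p => c * (p.1 ^ α.1 * p.2 ^ α.2)) 0 =
      if β = α then c * (β.1.factorial * β.2.factorial) else 0 := by
  rw [iterate_partialL_const_mul_monomial, iterate_partialX_const_mul_monomial]
  calc c * α.2.descFactorial β.2 * α.1.descFactorial β.1 * (0 ^ (α.1 - β.1) * 0 ^ (α.2 - β.2))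
      = c * ((α.1.descFactorial β.1 * 0 ^ (α.1 - β.1)) *
          (α.2.descFactorial β.2 * 0 ^ (α.2 - β.2))) := by ring
    _ = if β = α then c * (β.1.factorial * β.2.factorial) else 0 := by
      simp only [descFactorial_mul_zero_pow, Prod.ext_iff (x := β), and_comm (a := β.1 = α.1),
        ite_and, mul_ite, ite_mul, zero_mul, mul_zero]

end Monomials

section IteratedLeibniz

open Finset.HasAntidiagonal

variable {R A : Type*} [CommRing R] [CommRing A] [Algebra R A]

theorem derivation_pow_apply_mul (D : Derivation R A A) (n : ℕ) (a b : A) :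
    ((D : Module.End R A) ^ n) (a * b) = ∑ p ∈ antidiagonal n,
      n.choose p.1 • (((D : Module.End R A) ^ p.1) a * ((D : Module.End R A) ^ p.2) b) := by
  induction n with
  | zero => simp
  | succ n ih =>
    rw [Finset.sum_antidiagonal_choose_succ_nsmul
      (fun i j => ((D : Module.End R A) ^ i) a * ((D : Module.End R A) ^ j) b) n]
    simp only [pow_succ', Module.End.mul_apply, ih, map_sum, map_nsmul, Derivation.coeFn_coe,
      Derivation.leibniz, smul_eq_mul, nsmul_add, Finset.sum_add_distrib]
    congr 1
    refine Finset.sum_congr rfl fun ⟨i, j⟩ hij => ?_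
    rw [n.choose_symm_of_eq_add (mem_antidiagonal.1 hij).symm, mul_comm]

end IteratedLeibniz

open Finset.HasAntidiagonal in
theorem hahnSeries_coeff_mul_prod {R : Type*} [CommSemiring R] (x y : HahnSeries (ℕ × ℕ) R)
    (δ : ℕ × ℕ) :
    (x * y).coeff δ = ∑ q ∈ antidiagonal δ.2, ∑ p ∈ antidiagonal δ.1,
      x.coeff (p.1, q.1) * y.coeff (p.2, q.2) := by
  rw [HahnSeries.coeff_mul, ← Finset.sum_product_right']
  refine Finset.sum_of_injOn (Equiv.prodProdProdComm ℕ ℕ ℕ ℕ) (Equiv.injective _).injOn ?_ ?_ ?_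
  · rintro ⟨α, β⟩ h
    simp only [Finset.mem_coe, Finset.mem_antidiagonal] at h
    simp [← h.2.2]
  · rintro ⟨⟨a, b⟩, c, d⟩ h hn
    simp only [Finset.mem_product, mem_antidiagonal] at h
    by_contra hne
    exact hn ⟨((a, c), b, d), Finset.mem_coe.2 <| Finset.mem_antidiagonal.2
      ⟨left_ne_zero_of_mul hne, right_ne_zero_of_mul hne, Prod.ext h.1 h.2⟩, rfl⟩
  · rintro ⟨α, β⟩ _
    rfl

namespace SmoothGerm

/-- The germ of a function that is smooth near the origin. -/
noncomputable def ofFun (f : ℝ × ℝ → ℝ) (hf : ∀ᶠ p in 𝓝 (0 : ℝ × ℝ), ContDiffAt ℝ ∞ f p) :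
    SmoothGerm :=
  ⟨↑f, f, rfl, hf⟩

theorem exists_eq_ofFun (φ : SmoothGerm) : ∃ f hf, φ = ofFun f hf := by
  obtain ⟨_, f, rfl, hf⟩ := φ
  exact ⟨f, hf, rfl⟩

theorem eventually_contDiffAt_fderiv_apply {f : ℝ × ℝ → ℝ}
    (hf : ∀ᶠ p in 𝓝 (0 : ℝ × ℝ), ContDiffAt ℝ ∞ f p) (v : ℝ × ℝ) :
    ∀ᶠ p in 𝓝 (0 : ℝ × ℝ), ContDiffAt ℝ ∞ (fun q => fderiv ℝ f q v) p := by
  filter_upwards [hf] with p hp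
  exact (hp.fderiv_right (by simp)).clm_apply contDiffAt_const

/-- The derivative of smooth germs in the direction `v`, as a derivation of the ring of germs. -/
noncomputable def dirDeriv (v : ℝ × ℝ) : Derivation ℤ SmoothGerm SmoothGerm :=
  .mk' (AddMonoidHom.toIntLinearMap <| .mk' (fun φ =>
    ⟨Germ.map' (fun f p => fderiv ℝ f p v) (fun f g h => by
        filter_upwards [EventuallyEq.fderiv (𝕜 := ℝ) h] with p hp
        rw [hp]) φ.1, by
      obtain ⟨_, f, rfl, hf⟩ := φ
      exact ⟨_, rfl, eventually_contDiffAt_fderiv_apply hf v⟩⟩) (by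
    rintro ⟨_, f, rfl, hf⟩ ⟨_, g, rfl, hg⟩
    refine Subtype.ext (Germ.coe_eq.2 ?_)
    filter_upwards [hf, hg] with p hfp hgp
    exact DFunLike.congr_fun
      (fderiv_add (hfp.differentiableAt (by simp)) (hgp.differentiableAt (by simp))) v))
  (by
    rintro ⟨_, f, rfl, hf⟩ ⟨_, g, rfl, hg⟩
    refine Subtype.ext (Germ.coe_eq.2 ?_)
    filter_upwards [hf, hg] with p hfp hgp
    exact DFunLike.congr_fun
      (fderiv_mul (hfp.differentiableAt (by simp)) (hgp.differentiableAt (by simp))) v)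

/-- The value of a germ at the origin. -/
noncomputable def valueHom : SmoothGerm →+* ℝ := Germ.valueRingHom.comp smoothGermRing.subtype

theorem exists_dirDeriv_pow_ofFun (f : ℝ × ℝ → ℝ) (hf) (i j : ℕ) :
    ∃ h, ((dirDeriv (1, 0) : Module.End ℤ SmoothGerm) ^ i)
      (((dirDeriv (0, 1) : Module.End ℤ SmoothGerm) ^ j) (ofFun f hf)) =
        ofFun (partialX^[i] (partialL^[j] f)) h := by
  have exists_l : ∃ h, ((dirDeriv (0, 1) : Module.End ℤ SmoothGerm) ^ j) (ofFun f hf) =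
      ofFun (partialL^[j] f) h := by
    induction j with
    | zero => exact ⟨hf, rfl⟩
    | succ j ih =>
      obtain ⟨h, ih⟩ := ih
      simp only [pow_succ', Module.End.mul_apply, ih, Function.iterate_succ_apply']
      exact ⟨eventually_contDiffAt_fderiv_apply h _, rfl⟩
  induction i with
  | zero => exact exists_l
  | succ i ih =>
    obtain ⟨h, ih⟩ := ih
    simp only [pow_succ' _ i, Module.End.mul_apply, ih, Function.iterate_succ_apply']
    exact ⟨eventually_contDiffAt_fderiv_apply h _, rfl⟩

theorem taylorCoeff_ofFun (f : ℝ × ℝ → ℝ) (hf) (α : ℕ × ℕ) :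
    taylorCoeff (ofFun f hf) α =
      partialX^[α.1] (partialL^[α.2] f) 0 / (α.1.factorial * α.2.factorial) :=
  rfl

theorem taylorCoeff_eq_valueHom_dirDeriv (φ : SmoothGerm) (α : ℕ × ℕ) :
    taylorCoeff φ α = valueHom (((dirDeriv (1, 0) : Module.End ℤ SmoothGerm) ^ α.1)
      (((dirDeriv (0, 1) : Module.End ℤ SmoothGerm) ^ α.2) φ)) /
        (α.1.factorial * α.2.factorial) := by
  obtain ⟨f, hf, rfl⟩ := exists_eq_ofFun φ
  obtain ⟨h, hpow⟩ := exists_dirDeriv_pow_ofFun f hf α.1 α.2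
  rw [hpow]
  rfl

theorem taylorCoeff_term (c : ℝ) (α β : ℕ × ℕ) :
    taylorCoeff (term c α) β = if β = α then c else 0 := by
  have hsmooth : ContDiff ℝ ∞ fun p : ℝ × ℝ => c * (p.1 ^ α.1 * p.2 ^ α.2) := by fun_prop
  rw [show term c α = ofFun _ (.of_forall fun _ => hsmooth.contDiffAt) from rfl, taylorCoeff_ofFun,
    partialX_partialL_const_mul_monomial_zero, ite_div, zero_div,
    mul_div_cancel_right₀ c (by positivity)]

theorem one_eq_term : (1 : SmoothGerm) = term 1 0 :=
  Subtype.ext <| Germ.coe_eq.2 <| .of_forall fun p => by simp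

open Finset.HasAntidiagonal in
theorem taylorCoeff_mul (φ ψ : SmoothGerm) (δ : ℕ × ℕ) :
    taylorCoeff (φ * ψ) δ = ∑ q ∈ antidiagonal δ.2, ∑ p ∈ antidiagonal δ.1,
      taylorCoeff φ (p.1, q.1) * taylorCoeff ψ (p.2, q.2) := by
  rw [taylorCoeff_eq_valueHom_dirDeriv, derivation_pow_apply_mul, map_sum, map_sum,
    Finset.sum_div]
  refine Finset.sum_congr rfl fun q hq => ?_
  rw [map_nsmul, derivation_pow_apply_mul, map_nsmul, map_sum, Finset.smul_sum, Finset.sum_div]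
  refine Finset.sum_congr rfl fun p hp => ?_
  simp only [taylorCoeff_eq_valueHom_dirDeriv, map_mul, map_natCast, nsmul_eq_mul]
  rw [← mem_antidiagonal.1 hp, ← mem_antidiagonal.1 hq, Nat.cast_add_choose,
    Nat.cast_add_choose]
  have := Nat.factorial_ne_zero
  field_simp

/-- The Taylor series at the origin, as a homomorphism into the formal power series in two
variables. The latter are encoded as Hahn series with exponents in `ℕ × ℕ`, all of whose subsets are
partially well-ordered, so that the exponents are the ones of `taylorCoeff`. -/
noncomputable def taylorSeries : SmoothGerm →+* HahnSeries (ℕ × ℕ) ℝ where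
  toFun φ := ⟨taylorCoeff φ, Set.isPWO_of_wellQuasiOrderedLE _⟩
  map_zero' := HahnSeries.ext <| funext fun α => by
    simp [taylorCoeff_eq_valueHom_dirDeriv]
  map_one' := HahnSeries.ext <| funext fun α => by
    rw [one_eq_term]
    simp [taylorCoeff_term, HahnSeries.coeff_one]
  map_add' φ ψ := HahnSeries.ext <| funext fun α => by
    simp [taylorCoeff_eq_valueHom_dirDeriv, add_div]
  map_mul' φ ψ := HahnSeries.ext <| funext fun α => by
    rw [hahnSeries_coeff_mul_prod]
    exact taylorCoeff_mul φ ψ α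

theorem coeff_taylorSeries (φ : SmoothGerm) (α : ℕ × ℕ) :
    (taylorSeries φ).coeff α = taylorCoeff φ α :=
  rfl

theorem support_taylorSeries (φ : SmoothGerm) : (taylorSeries φ).support = support φ :=
  rfl

theorem taylorSeries_term (c : ℝ) (α : ℕ × ℕ) :
    taylorSeries (term c α) = HahnSeries.single α c :=
  HahnSeries.ext <| funext fun β => by
    rw [coeff_taylorSeries, taylorCoeff_term, HahnSeries.coeff_single]
    congr

theorem taylorCoeff_add (φ ψ : SmoothGerm) (α : ℕ × ℕ) :
    taylorCoeff (φ + ψ) α = taylorCoeff φ α + taylorCoeff ψ α := by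
  rw [← coeff_taylorSeries, map_add]
  rfl

theorem taylorCoeff_sub (φ ψ : SmoothGerm) (α : ℕ × ℕ) :
    taylorCoeff (φ - ψ) α = taylorCoeff φ α - taylorCoeff ψ α := by
  rw [← coeff_taylorSeries, map_sub]
  rfl

theorem mem_support {φ : SmoothGerm} {α : ℕ × ℕ} : α ∈ support φ ↔ taylorCoeff φ α ≠ 0 :=
  Iff.rfl

theorem isUnit_of_taylorCoeff_zero_ne_zero {φ : SmoothGerm} (h : taylorCoeff φ 0 ≠ 0) :
    IsUnit φ := by
  obtain ⟨f, hf, rfl⟩ := exists_eq_ofFun φ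
  have hf0 : f 0 ≠ 0 := by simpa [taylorCoeff_ofFun] using h
  have hne : ∀ᶠ p in 𝓝 (0 : ℝ × ℝ), f p ≠ 0 := hf.self_of_nhds.continuousAt.eventually_ne hf0
  refine IsUnit.of_mul_eq_one (ofFun (fun p => (f p)⁻¹) ?_) ?_
  · filter_upwards [hf, hne] with p hfp hp using hfp.inv hp
  · refine Subtype.ext (Germ.coe_eq.2 ?_)
    filter_upwards [hne] with p hp using mul_inv_cancel₀ hp

end SmoothGerm

section Borel

/-- A fixed bump function around the origin. -/
noncomputable def originBump : ContDiffBump (0 : ℝ × ℝ) := ⟨1, 2, one_pos, one_lt_two⟩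

/-- The monomial `x^i l^j`, for `α = (i, j)`, multiplied by a fixed cutoff function. It is a
compactly supported function with the germ of `x^i l^j` at the origin. -/
noncomputable def cutoffMonomial (α : ℕ × ℕ) (p : ℝ × ℝ) : ℝ :=
  p.1 ^ α.1 * p.2 ^ α.2 * originBump p

theorem contDiff_cutoffMonomial (α : ℕ × ℕ) : ContDiff ℝ ∞ (cutoffMonomial α) :=
  ((contDiff_fst.pow _).mul (contDiff_snd.pow _)).mul originBump.contDiff

theorem hasCompactSupport_cutoffMonomial (α : ℕ × ℕ) : HasCompactSupport (cutoffMonomial α) :=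
  originBump.hasCompactSupport.mul_left

theorem cutoffMonomial_smul_eventuallyEq (c : ℝ) {t : ℝ} (ht : t ≠ 0) (α : ℕ × ℕ) :
    (fun p => (c * t⁻¹ ^ (α.1 + α.2)) • cutoffMonomial α (t • p)) =ᶠ[𝓝 0]
      fun p => c * (p.1 ^ α.1 * p.2 ^ α.2) := by
  have hsmul : Tendsto (fun p : ℝ × ℝ => t • p) (𝓝 0) (𝓝 0) := by
    simpa only [smul_zero] using (continuous_const_smul t).tendsto (0 : ℝ × ℝ)
  filter_upwards [hsmul.eventually originBump.eventuallyEq_one] with p hp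
  simp only [cutoffMonomial, hp, Prod.smul_fst, Prod.smul_snd, smul_eq_mul, mul_pow, pow_add,
    inv_pow, Pi.one_apply]
  field_simp

theorem exists_eventuallyEq_monomial_iteratedFDeriv_le (c : ℝ) (α : ℕ × ℕ) {ε : ℝ} (hε : 0 < ε) :
    ∃ f : ℝ × ℝ → ℝ, ContDiff ℝ ∞ f ∧ HasCompactSupport f ∧
      f =ᶠ[𝓝 0] (fun p => c * (p.1 ^ α.1 * p.2 ^ α.2)) ∧
      ∀ k < α.1 + α.2, ∀ p, ‖iteratedFDeriv ℝ k f p‖ ≤ ε := by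
  obtain ⟨t, ht, hle⟩ := exists_dilation_iteratedFDeriv_le (contDiff_cutoffMonomial α)
    (exists_norm_iteratedFDeriv_le (contDiff_cutoffMonomial α) (hasCompactSupport_cutoffMonomial α))
    c (α.1 + α.2) hε
  exact ⟨_, ((contDiff_cutoffMonomial α).comp (contDiff_const_smul t)).const_smul _,
    ((hasCompactSupport_cutoffMonomial α).comp_smul ht).smul_left,
    cutoffMonomial_smul_eventuallyEq c ht α, hle⟩

theorem exists_smoothlySummable_eventuallyEq_monomial (a : ℕ × ℕ → ℝ) :
    ∃ f : ℕ × ℕ → ℝ × ℝ → ℝ, SmoothlySummable f ∧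
      ∀ α, f α =ᶠ[𝓝 0] fun p => a α * (p.1 ^ α.1 * p.2 ^ α.2) := by
  obtain ⟨u, hu_pos, _, hu, _⟩ := posSumOfEncodable one_pos (ℕ × ℕ)
  choose f hsmooth hsupp hmonomial hle using fun α =>
    exists_eventuallyEq_monomial_iteratedFDeriv_le (a α) α (hu_pos α)
  refine ⟨f, .of_eventually_le hsmooth
    (fun α => exists_norm_iteratedFDeriv_le (hsmooth α) (hsupp α)) hu.summable fun k => ?_,
    hmonomial⟩
  rw [eventually_cofinite]
  refine (Set.finite_Iic (k, k)).subset fun α hα => ?_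
  have hk : α.1 + α.2 ≤ k := not_lt.1 fun hk => hα (hle α k hk)
  exact ⟨(Nat.le_add_right _ _).trans hk, (Nat.le_add_left _ _).trans hk⟩

theorem SmoothGerm.taylorSeries_surjective : Function.Surjective SmoothGerm.taylorSeries := by
  intro a
  obtain ⟨f, hf, hmonomial⟩ := exists_smoothlySummable_eventuallyEq_monomial a.coeff
  refine ⟨ofFun _ (.of_forall fun _ => hf.contDiff_tsum.contDiffAt),
    HahnSeries.ext <| funext fun β => ?_⟩
  have hpartial : ∀ α, partialX^[β.1] (partialL^[β.2] (f α)) 0 =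
      if β = α then a.coeff α * (β.1.factorial * β.2.factorial) else 0 := fun α => by
    rw [← partialX_partialL_const_mul_monomial_zero]
    exact (partialX_iterate_congr (partialL_iterate_congr (hmonomial α) _) _).eq_of_nhds
  rw [coeff_taylorSeries, taylorCoeff_ofFun, hf.partialX_partialL_tsum]
  simp only [hpartial]
  rw [tsum_eq_single β fun α hα => if_neg hα.symm, if_pos rfl,
    mul_div_cancel_right₀ _ (by positivity)]

end Borel

namespace LocalOrder

theorem wellFounded (ord : LocalOrder) : WellFounded fun α β => ord.lt β α := by
  refine WellFounded.wellFounded_iff_has_min.2 fun S hS => ?_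
  obtain ⟨α, hα, hmax⟩ := ord.exists_max hS
  refine ⟨α, hα, fun β hβ hlt => ?_⟩
  have hne : β ≠ α := fun h => ord.irrefl _ (h ▸ hlt)
  exact ord.irrefl _ (ord.trans _ _ _ hlt (hmax β hβ hne))

theorem add_left (ord : LocalOrder) {α β : ℕ × ℕ} (h : ord.lt α β) (γ : ℕ × ℕ) :
    ord.lt (γ + α) (γ + β) := by
  simpa only [add_comm γ] using ord.add_right _ _ γ h

/-- `α` is the largest element of `S` in a local order, as for the leading exponent of a power
series with support `S`. -/
def IsMax (ord : LocalOrder) (S : Set (ℕ × ℕ)) (α : ℕ × ℕ) : Prop :=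
  α ∈ S ∧ ∀ β ∈ S, β ≠ α → ord.lt β α

theorem IsMax.unique {ord : LocalOrder} {S : Set (ℕ × ℕ)} {α β : ℕ × ℕ} (hα : ord.IsMax S α)
    (hβ : ord.IsMax S β) : α = β := by
  by_contra hne
  exact ord.irrefl _ (ord.trans _ _ _ (hβ.2 α hα.1 hne) (hα.2 β hβ.1 (Ne.symm hne)))

end LocalOrder

section Division

theorem exists_fixedPoint_of_wellFounded {A B : Type*} [Nonempty B] {r : A → A → Prop}
    (hr : WellFounded r) (F : (A → B) → A → B)
    (hF : ∀ h h' a, (∀ b, r b a → h b = h' b) → F h a = F h' a) : ∃ h, F h = h := by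
  classical
  let extend (a : A) (rec : ∀ b, r b a → B) (b : A) : B :=
    if hb : r b a then rec b hb else Classical.arbitrary B
  refine ⟨hr.fix fun a rec => F (extend a rec) a, funext fun a => ?_⟩
  conv_rhs => rw [hr.fix_eq]
  exact hF _ _ _ fun b hb => by simp only [extend, dif_pos hb]

theorem exists_pairwiseDisjoint_iUnion_eq {ι A : Type*} (s : Set ι) (S : ι → Set A) :
    ∃ D : ι → Set A, (∀ i, D i ⊆ S i) ∧ s.PairwiseDisjoint D ∧ ⋃ i ∈ s, D i = ⋃ i ∈ s, S i := by
  have hcell (x) : ∃ o : Option ι, x ∈ ⋃ i ∈ s, S i → ∃ i ∈ s, x ∈ S i ∧ o = some i := by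
    by_cases hx : x ∈ ⋃ i ∈ s, S i
    · obtain ⟨i, hi, hxi⟩ := Set.mem_iUnion₂.1 hx
      exact ⟨some i, fun _ => ⟨i, hi, hxi, rfl⟩⟩
    · exact ⟨none, fun h => absurd h hx⟩
  choose cell hcell using hcell
  refine ⟨fun i => {x ∈ S i | cell x = some i}, fun i => Set.sep_subset _ _, ?_, ?_⟩
  · refine fun i _ j _ hij => Set.disjoint_left.2 fun x hi hj => hij ?_
    exact Option.some_injective _ (hi.2.symm.trans hj.2)
  · refine (Set.iUnion₂_mono fun i _ => Set.sep_subset _ _).antisymm fun x hx => ?_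
    obtain ⟨i, hi, hxi, hcell_x⟩ := hcell x hx
    exact Set.mem_iUnion₂.2 ⟨i, hi, hxi, hcell_x⟩

theorem LocalOrder.IsMax.lt_of_mem_support_sub_single {ord : LocalOrder} {R : Type*} [AddGroup R]
    {x : HahnSeries (ℕ × ℕ) R} {α ν : ℕ × ℕ} (hα : ord.IsMax x.support α)
    (hν : ν ∈ (x - HahnSeries.single α (x.coeff α)).support) : ord.lt ν α := by
  have hne : ν ≠ α := by
    rintro rfl
    simp at hν
  refine hα.2 ν ?_ hne
  rwa [HahnSeries.mem_support, HahnSeries.coeff_sub, HahnSeries.coeff_single_of_ne hne,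
    sub_zero] at hν

variable {K : Type*} [Field K]

/-- The quotient by the term with exponent `α` and coefficient `c` of the part of the power series
`h` with exponents in `D`. It is meant for sets `D` of multiples of `α`, and it takes the
coefficient function of `h` because the division algorithm defines `h` by recursion on exponents. -/
noncomputable def termQuotient (D : Set (ℕ × ℕ)) (α : ℕ × ℕ) (c : K) (h : ℕ × ℕ → K) :
    HahnSeries (ℕ × ℕ) K where
  coeff μ := D.indicator h (μ + α) / c
  isPWO_support' := Set.isPWO_of_wellQuasiOrderedLE _

theorem ne_zero_of_mem_support_termQuotient {D : Set (ℕ × ℕ)} {α μ : ℕ × ℕ} {c : K}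
    {h : ℕ × ℕ → K} (hμ : μ ∈ (termQuotient D α c h).support) : h (μ + α) ≠ 0 := by
  intro h0
  rw [HahnSeries.mem_support, termQuotient] at hμ
  simp [h0] at hμ

theorem termQuotient_sub (D : Set (ℕ × ℕ)) (α : ℕ × ℕ) (c : K) (h h' : ℕ × ℕ → K) :
    termQuotient D α c (h - h') = termQuotient D α c h - termQuotient D α c h' :=
  HahnSeries.ext <| funext fun μ => by simp [termQuotient, Set.indicator_sub', sub_div]

theorem coeff_termQuotient_mul_single {D : Set (ℕ × ℕ)} {α : ℕ × ℕ} {c : K} (hD : D ⊆ Set.Ici α)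
    (hc : c ≠ 0) (h : ℕ × ℕ → K) (δ : ℕ × ℕ) :
    (termQuotient D α c h * HahnSeries.single α c).coeff δ = D.indicator h δ := by
  by_cases hδ : α ≤ δ
  · obtain ⟨μ, rfl⟩ := exists_add_of_le hδ
    rw [add_comm, HahnSeries.coeff_mul_single_add]
    exact div_mul_cancel₀ _ hc
  · rw [Set.indicator_of_notMem fun hmem => hδ (hD hmem)]
    by_contra hne
    obtain ⟨μ, _, ν, hν, rfl⟩ := Set.mem_add.1 (HahnSeries.support_mul_subset hne)
    rw [HahnSeries.support_single_of_ne hc, Set.mem_singleton_iff] at hν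
    exact hδ (hν ▸ le_add_self)

theorem sum_coeff_termQuotient_mul_single {ι : Type*} {s : Finset ι} {D : ι → Set (ℕ × ℕ)}
    {α : ι → ℕ × ℕ} {c : ι → K} (hdisj : (s : Set ι).PairwiseDisjoint D)
    (hD : ∀ i ∈ s, D i ⊆ Set.Ici (α i)) (hc : ∀ i ∈ s, c i ≠ 0) (h : ℕ × ℕ → K) (δ : ℕ × ℕ) :
    ∑ i ∈ s, (termQuotient (D i) (α i) (c i) h * HahnSeries.single (α i) (c i)).coeff δ =
      (⋃ i ∈ s, D i).indicator h δ := by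
  rw [Finset.indicator_biUnion_apply s D hdisj δ]
  exact Finset.sum_congr rfl fun i hi => coeff_termQuotient_mul_single (hD i hi) (hc i hi) h δ

theorem LocalOrder.exists_lt_of_mem_support_termQuotient_mul (ord : LocalOrder)
    {D : Set (ℕ × ℕ)} {α δ : ℕ × ℕ} {c : K} {h : ℕ × ℕ → K} {y : HahnSeries (ℕ × ℕ) K}
    (hy : ∀ ν ∈ y.support, ord.lt ν α) (hδ : δ ∈ (termQuotient D α c h * y).support) :
    ∃ γ, h γ ≠ 0 ∧ ord.lt δ γ := by
  obtain ⟨μ, hμ, ν, hν, rfl⟩ := Set.mem_add.1 (HahnSeries.support_mul_subset hδ)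
  exact ⟨μ + α, ne_zero_of_mem_support_termQuotient hμ, ord.add_left (hy ν hν) μ⟩

/-- The coefficient of the right-hand side at `δ` only involves the values of `h` at larger
exponents, because the exponents of `y i` are smaller than `α i`. -/
theorem LocalOrder.exists_eq_indicator_coeff_sub_termQuotient_mul (ord : LocalOrder) {ι : Type*}
    {s : Finset ι} {α : ι → ℕ × ℕ} {y : ι → HahnSeries (ℕ × ℕ) K}
    (hy : ∀ i ∈ s, ∀ ν ∈ (y i).support, ord.lt ν (α i)) (f : HahnSeries (ℕ × ℕ) K)
    (U : Set (ℕ × ℕ)) (D : ι → Set (ℕ × ℕ)) (c : ι → K) :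
    ∃ h : ℕ × ℕ → K,
      U.indicator (f - ∑ i ∈ s, termQuotient (D i) (α i) (c i) h * y i).coeff = h := by
  refine exists_fixedPoint_of_wellFounded ord.wellFounded
    (fun h => U.indicator (f - ∑ i ∈ s, termQuotient (D i) (α i) (c i) h * y i).coeff)
    fun h h' δ heq => ?_
  have hcoeff : (f - ∑ i ∈ s, termQuotient (D i) (α i) (c i) h * y i).coeff δ =
      (f - ∑ i ∈ s, termQuotient (D i) (α i) (c i) h' * y i).coeff δ := by
    simp only [HahnSeries.coeff_sub, HahnSeries.coeff_sum]
    refine congrArg _ (Finset.sum_congr rfl fun i hi => ?_)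
    rw [← sub_eq_zero, ← HahnSeries.coeff_sub, ← sub_mul, ← termQuotient_sub]
    by_contra hne
    obtain ⟨γ, hγ, hlt⟩ := ord.exists_lt_of_mem_support_termQuotient_mul (hy i hi) hne
    exact hγ (sub_eq_zero.2 (heq γ hlt))
  simp only [Set.indicator, hcoeff]

/-- The power series `h` is the sum of the products of the quotients with the leading terms, and `e`
what the products with the tails leave of `f`, so that `e - h` is the remainder. -/
theorem LocalOrder.exists_formalDivision (ord : LocalOrder) {ι : Type*} (s : Finset ι)
    {g : ι → HahnSeries (ℕ × ℕ) K} {α : ι → ℕ × ℕ} (hα : ∀ i ∈ s, ord.IsMax (g i).support (α i))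
    (f : HahnSeries (ℕ × ℕ) K) :
    ∃ q : ι → HahnSeries (ℕ × ℕ) K,
      (∀ i ∈ s, ∀ δ, α i ≤ δ → δ ∉ (f - ∑ i ∈ s, q i * g i).support) ∧
      ∀ β, (∀ γ ∈ f.support, ord.lt γ β) →
        (∀ i ∈ s, ∀ μ ∈ (q i).support, ord.lt (μ + α i) β) ∧
        ∀ δ ∈ (f - ∑ i ∈ s, q i * g i).support, ord.lt δ β := by
  obtain ⟨D, hD, hdisj, hunion⟩ :=
    exists_pairwiseDisjoint_iUnion_eq (s : Set ι) fun i => Set.Ici (α i)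
  let U := ⋃ i ∈ s, Set.Ici (α i)
  let c i := (g i).coeff (α i)
  let tail i := g i - HahnSeries.single (α i) (c i)
  have htail : ∀ i ∈ s, ∀ ν ∈ (tail i).support, ord.lt ν (α i) := fun i hi ν hν =>
    (hα i hi).lt_of_mem_support_sub_single hν
  obtain ⟨h, indicator_e⟩ := ord.exists_eq_indicator_coeff_sub_termQuotient_mul htail f U D c
  let q i := termQuotient (D i) (α i) (c i) h
  set e := f - ∑ i ∈ s, q i * tail i with he
  have coeff_remainder (δ) : (f - ∑ i ∈ s, q i * g i).coeff δ = e.coeff δ - h δ := by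
    have hlead : ∑ i ∈ s, (q i * HahnSeries.single (α i) (c i)).coeff δ = h δ := by
      rw [sum_coeff_termQuotient_mul_single hdisj (fun i _ => hD i) (fun i hi => (hα i hi).1)]
      rw [show ⋃ i ∈ s, D i = U from hunion, ← indicator_e, Set.indicator_indicator,
        Set.inter_self]
    simp only [he, tail, mul_sub, Finset.sum_sub_distrib, HahnSeries.coeff_sub,
      HahnSeries.coeff_sum, hlead]
    ring
  have of_h_ne_zero {δ} (hδ : h δ ≠ 0) : e.coeff δ ≠ 0 := fun h0 => hδ <| by
    rw [← indicator_e, Set.indicator_apply_eq_zero]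
    exact fun _ => h0
  refine ⟨q, fun i hi δ hδ => ?_, fun β hβ => ?_⟩
  · have hδU : δ ∈ U := Set.mem_biUnion (s := (s : Set ι)) hi hδ
    rw [HahnSeries.mem_support, not_not, coeff_remainder, ← indicator_e, Set.indicator_of_mem hδU]
    exact sub_self _
  · have lt_of_e_ne_zero (δ) : e.coeff δ ≠ 0 → ord.lt δ β := by
      induction δ using ord.wellFounded.induction with | _ δ ih
      intro hδ
      by_cases hf : f.coeff δ = 0
      · rw [HahnSeries.coeff_sub, hf, zero_sub, neg_ne_zero, HahnSeries.coeff_sum] at hδ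
        obtain ⟨i, hi, hne⟩ := Finset.exists_ne_zero_of_sum_ne_zero hδ
        obtain ⟨γ, hγ, hlt⟩ := ord.exists_lt_of_mem_support_termQuotient_mul (htail i hi) hne
        exact ord.trans _ _ _ hlt (ih γ hlt (of_h_ne_zero hγ))
      · exact hβ δ hf
    refine ⟨fun i _ μ hμ => lt_of_e_ne_zero _ <| of_h_ne_zero <|
      ne_zero_of_mem_support_termQuotient hμ, fun δ hδ => lt_of_e_ne_zero δ fun h0 => ?_⟩
    have hh0 : h δ = 0 := not_not.1 fun hne => of_h_ne_zero hne h0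
    exact hδ (by rw [coeff_remainder, h0, hh0, sub_self])

end Division

section Generators

variable {R ι : Type*} [CommRing R]

theorem span_insert_eq_span_insert_of_isUnit_mul_sub_mem {S : Set R} {u a b : R} (hu : IsUnit u)
    (h : u * a - b ∈ Ideal.span S) : Ideal.span (insert a S) = Ideal.span (insert b S) := by
  have hS (x : R) : Ideal.span S ≤ Ideal.span (insert x S) :=
    Ideal.span_mono (Set.subset_insert x S)
  have mem_self (x : R) : x ∈ Ideal.span (insert x S) := Ideal.subset_span (Set.mem_insert x S)
  refine le_antisymm ?_ ?_ <;> rw [Ideal.span_le, Set.insert_subset_iff]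
  · refine ⟨(Ideal.unit_mul_mem_iff_mem _ hu).1 ?_, Ideal.subset_span.trans (hS b)⟩
    simpa using add_mem (hS b h) (mem_self b)
  · refine ⟨?_, Ideal.subset_span.trans (hS a)⟩
    simpa using sub_mem (Ideal.mul_mem_left _ u (mem_self a)) (hS a h)

theorem range_eq_insert_image_compl {A : Type*} (g : ι → A) (j : ι) :
    Set.range g = insert (g j) (g '' {j}ᶜ) := by
  rw [← Set.image_insert_eq, Set.insert_eq, Set.union_compl_self, Set.image_univ]

theorem span_range_update_eq [DecidableEq ι] {g : ι → R} {j : ι} {u b : R} (hu : IsUnit u)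
    (h : u * g j - b ∈ Ideal.span (g '' {j}ᶜ)) :
    Ideal.span (Set.range (Function.update g j b)) = Ideal.span (Set.range g) := by
  have himage : Function.update g j b '' {j}ᶜ = g '' {j}ᶜ :=
    Set.image_congr fun k hk => Function.update_of_ne hk b g
  rw [range_eq_insert_image_compl g j, range_eq_insert_image_compl _ j, himage,
    Function.update_self, span_insert_eq_span_insert_of_isUnit_mul_sub_mem hu h]

end Generators

theorem upperSet_wellFoundedLT {A : Type*} [Preorder A] [WellQuasiOrderedLE A] :
    WellFoundedLT (UpperSet A) := by
  refine ⟨RelEmbedding.wellFounded_iff_isEmpty.2 ⟨fun U => ?_⟩⟩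
  have hlt {m n : ℕ} (h : m < n) : U n < U m := U.map_rel_iff.2 h
  choose x hx hx' using fun n => Set.exists_of_ssubset (hlt (Nat.lt_succ_self n))
  obtain ⟨m, n, hmn, hle⟩ := wellQuasiOrdered_le x
  have hmem : x m ∈ U n := by
    rcases (Nat.succ_le_of_lt hmn).eq_or_lt with h | h
    · exact h ▸ hx m
    · exact (hlt h).le (hx m)
  exact hx' n ((U n).upper hle hmem)

namespace SmoothGerm

theorem taylorCoeff_term_zero_mul (c : ℝ) (φ : SmoothGerm) (δ : ℕ × ℕ) :
    taylorCoeff (term c 0 * φ) δ = c * taylorCoeff φ δ := by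
  rw [← coeff_taylorSeries, map_mul, taylorSeries_term, HahnSeries.coeff_single_zero_mul,
    coeff_taylorSeries]

theorem term_mul_term (c d : ℝ) (α β : ℕ × ℕ) : term c α * term d β = term (c * d) (α + β) :=
  Subtype.ext <| Germ.coe_eq.2 <| .of_forall fun p => by
    simp only [Prod.fst_add, Prod.snd_add, pow_add]
    ring

theorem term_zero_left (α : ℕ × ℕ) : term 0 α = 0 :=
  Subtype.ext <| Germ.coe_eq.2 <| .of_forall fun _ => zero_mul _

theorem term_dvd_term_iff {c d : ℝ} (hc : c ≠ 0) (hd : d ≠ 0) {α β : ℕ × ℕ} :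
    term c α ∣ term d β ↔ α ≤ β := by
  refine ⟨fun ⟨φ, h⟩ => ?_, fun h => ⟨term (d / c) (β - α), ?_⟩⟩
  · have hβ : β ∈ (HahnSeries.single α c * taylorSeries φ).support := by
      rw [← taylorSeries_term, ← map_mul, ← h, taylorSeries_term]
      simpa using hd
    obtain ⟨μ, hμ, ν, -, rfl⟩ := Set.mem_add.1 (HahnSeries.support_mul_subset hβ)
    rw [HahnSeries.support_single_of_ne hc, Set.mem_singleton_iff] at hμ
    exact hμ ▸ le_self_add
  · rw [term_mul_term, mul_div_cancel₀ _ hc, add_tsub_cancel_of_le h]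

theorem isMax_support_leadExp (ord : LocalOrder) {φ : SmoothGerm} (h : ¬ IsFlat φ) :
    ord.IsMax (support φ) (leadExp ord φ) := by
  have hne : (support φ).Nonempty := not_forall.1 h
  rw [leadExp, dif_pos hne]
  exact (ord.exists_max hne).choose_spec

theorem not_isFlat_of_mem_support {φ : SmoothGerm} {α : ℕ × ℕ} (h : α ∈ support φ) : ¬ IsFlat φ :=
  fun hφ => h (hφ α)

theorem leadExp_eq {ord : LocalOrder} {φ : SmoothGerm} {α : ℕ × ℕ}
    (h : ord.IsMax (support φ) α) : leadExp ord φ = α :=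
  (isMax_support_leadExp ord (not_isFlat_of_mem_support h.1)).unique h

theorem leadCoeff_ne_zero (ord : LocalOrder) {φ : SmoothGerm} (h : ¬ IsFlat φ) :
    leadCoeff ord φ ≠ 0 :=
  (isMax_support_leadExp ord h).1

theorem leadTerm_of_isFlat (ord : LocalOrder) {φ : SmoothGerm} (h : IsFlat φ) :
    leadTerm ord φ = 0 := by
  rw [leadTerm, leadCoeff, h, term_zero_left]

theorem leadTerm_dvd_term_iff (ord : LocalOrder) {φ : SmoothGerm} {c : ℝ} (hc : c ≠ 0)
    {β : ℕ × ℕ} : leadTerm ord φ ∣ term c β ↔ ¬ IsFlat φ ∧ leadExp ord φ ≤ β := by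
  by_cases h : IsFlat φ
  · have hterm : term c β ≠ 0 := fun h0 => hc <| by
      simpa [taylorSeries_term] using congrArg taylorSeries h0
    simp [leadTerm_of_isFlat ord h, hterm, h]
  · simp [leadTerm, term_dvd_term_iff (leadCoeff_ne_zero ord h) hc, h]

theorem exists_division (ord : LocalOrder) {ι : Type*} (s : Finset ι) {g : ι → SmoothGerm}
    (hg : ∀ i ∈ s, ¬ IsFlat (g i)) (φ : SmoothGerm) :
    ∃ q : ι → SmoothGerm,
      (∀ i ∈ s, ∀ δ, leadExp ord (g i) ≤ δ → δ ∉ support (φ - ∑ i ∈ s, q i * g i)) ∧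
      ∀ β, (∀ γ ∈ support φ, ord.lt γ β) →
        (∀ i ∈ s, ∀ μ ∈ support (q i), ord.lt (μ + leadExp ord (g i)) β) ∧
        ∀ δ ∈ support (φ - ∑ i ∈ s, q i * g i), ord.lt δ β := by
  obtain ⟨Q, hQ⟩ := ord.exists_formalDivision s (g := fun i => taylorSeries (g i))
    (fun i hi => isMax_support_leadExp ord (hg i hi)) (taylorSeries φ)
  choose q hq using fun i => taylorSeries_surjective (Q i)
  refine ⟨q, ?_⟩
  simpa only [← support_taylorSeries, map_sub, map_sum, map_mul, hq] using hQ

/-- The exponents of the monomials that are divisible by the leading monomial of some member of the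
family `g`. -/
def leadUpperSet (ord : LocalOrder) {ι : Type*} (g : ι → SmoothGerm) : UpperSet (ℕ × ℕ) where
  carrier := {δ | ∃ i, ¬ IsFlat (g i) ∧ leadExp ord (g i) ≤ δ}
  upper' _ _ h := fun ⟨i, hi, hle⟩ => ⟨i, hi, hle.trans h⟩

theorem mem_leadUpperSet {ord : LocalOrder} {ι : Type*} {g : ι → SmoothGerm} {δ : ℕ × ℕ} :
    δ ∈ leadUpperSet ord g ↔ ∃ i, ¬ IsFlat (g i) ∧ leadExp ord (g i) ≤ δ :=
  Iff.rfl

variable {ord : LocalOrder} {ι : Type*}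

/-- The measure which decreases when the leading monomials of a finite family are made pairwise
indivisible: first the exponents that remain outside `leadUpperSet`, then the number of members that
are not flat. -/
noncomputable def leadMeasure (ord : LocalOrder) (g : ι → SmoothGerm) :
    UpperSet (ℕ × ℕ) ×ₗ ℕ :=
  toLex (leadUpperSet ord g, {i | ¬ IsFlat (g i)}.ncard)

variable [Finite ι]

theorem leadMeasure_update_lt [DecidableEq ι] {g : ι → SmoothGerm} {i j : ι}
    (hij : i ≠ j) (hi : ¬ IsFlat (g i)) (hj : ¬ IsFlat (g j))
    (hle : leadExp ord (g i) ≤ leadExp ord (g j)) {r : SmoothGerm}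
    (hr : ∀ k ≠ j, ¬ IsFlat (g k) → ∀ δ ∈ support r, ¬ leadExp ord (g k) ≤ δ) :
    leadMeasure ord (Function.update g j r) < leadMeasure ord g := by
  set g' := Function.update g j r
  have g'_self : g' j = r := Function.update_self j r g
  have g'_of_ne {k} (hk : k ≠ j) : g' k = g k := Function.update_of_ne hk r g
  have hleU : leadUpperSet ord g' ≤ leadUpperSet ord g := by
    rintro δ ⟨k, hk, hkδ⟩
    rcases eq_or_ne k j with rfl | hkj
    · exact ⟨i, by rwa [g'_of_ne hij], by rw [g'_of_ne hij]; exact hle.trans hkδ⟩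
    · exact ⟨k, by rwa [g'_of_ne hkj], by rwa [g'_of_ne hkj]⟩
  refine Prod.Lex.toLex_lt_toLex'.2 ⟨hleU, fun heqU : leadUpperSet ord g' = _ => ?_⟩
  have hflat : IsFlat r := by
    by_contra hr0
    have hmem : leadExp ord r ∈ leadUpperSet ord g' := ⟨j, by rwa [g'_self], by rw [g'_self]⟩
    obtain ⟨k, hk, hkr⟩ := mem_leadUpperSet.1 (heqU ▸ hmem)
    have hlead := (isMax_support_leadExp ord hr0).1
    rcases eq_or_ne k j with rfl | hkj
    · exact hr i hij hi _ hlead (hle.trans hkr)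
    · exact hr k hkj hk _ hlead hkr
  refine Set.ncard_lt_ncard ((Set.ssubset_iff_of_subset fun k hk => ?_).2
    ⟨j, hj, fun hj' => hj' (g'_self.symm ▸ hflat)⟩)
  have hkj : k ≠ j := fun h => hk (by rwa [h, g'_self])
  rwa [Set.mem_ofPred_eq, g'_of_ne hkj] at hk

theorem exists_leadMeasure_lt {g : ι → SmoothGerm} {i j : ι}
    (hij : i ≠ j) (hi : ¬ IsFlat (g i)) (hj : ¬ IsFlat (g j))
    (hle : leadExp ord (g i) ≤ leadExp ord (g j)) :
    ∃ g' : ι → SmoothGerm, Ideal.span (Set.range g') = Ideal.span (Set.range g) ∧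
      leadMeasure ord g' < leadMeasure ord g := by
  classical
  have := Fintype.ofFinite ι
  let s : Finset ι := {k | k ≠ j ∧ ¬ IsFlat (g k)}
  have mem_s {k} : k ∈ s ↔ k ≠ j ∧ ¬ IsFlat (g k) := Finset.mem_filter_univ k
  obtain ⟨q, hq, -⟩ := exists_division ord s (fun k hk => (mem_s.1 hk).2) (g j)
  have hspan : 1 * g j - (g j - ∑ k ∈ s, q k * g k) ∈ Ideal.span (g '' {j}ᶜ) := by
    rw [one_mul, sub_sub_cancel]
    exact Ideal.sum_mem _ fun k hk => Ideal.mul_mem_left _ _ <|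
      Ideal.subset_span <| Set.mem_image_of_mem g (mem_s.1 hk).1
  exact ⟨_, span_range_update_eq isUnit_one hspan, leadMeasure_update_lt hij hi hj hle
    fun k hkj hk δ hδ hle => hq k (mem_s.2 ⟨hkj, hk⟩) δ hle hδ⟩

theorem exists_pairwise_not_leadExp_le (ord : LocalOrder) (f : ι → SmoothGerm) :
    ∃ g : ι → SmoothGerm, Ideal.span (Set.range g) = Ideal.span (Set.range f) ∧
      leadUpperSet ord g ≤ leadUpperSet ord f ∧
      ∀ i j, i ≠ j → ¬ IsFlat (g i) → ¬ IsFlat (g j) →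
        ¬ leadExp ord (g i) ≤ leadExp ord (g j) := by
  have := upperSet_wellFoundedLT (A := ℕ × ℕ)
  obtain ⟨g, ⟨hspan, hleU⟩, hmin⟩ := (InvImage.wf (leadMeasure ord) wellFounded_lt).has_min
    {g : ι → SmoothGerm | Ideal.span (Set.range g) = Ideal.span (Set.range f) ∧
      leadMeasure ord g ≤ leadMeasure ord f} ⟨f, rfl, le_rfl⟩
  refine ⟨g, hspan, (Prod.Lex.le_iff'.1 hleU).1, fun i j hij hi hj hle => ?_⟩
  obtain ⟨g', hspan', hlt⟩ := exists_leadMeasure_lt hij hi hj hle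
  exact hmin g' ⟨hspan'.trans hspan, hlt.le.trans hleU⟩ hlt

/-- A normal form of a single germ relative to the set `U` of the exponents of reducible monomials:
its leading coefficient is `1`, and its only reducible monomial, if any, is the leading one. -/
def IsMonicReduced (ord : LocalOrder) (U : UpperSet (ℕ × ℕ)) (ψ : SmoothGerm) : Prop :=
  leadCoeff ord ψ = 1 ∧ ∀ δ ∈ support ψ, δ ∈ U → δ = leadExp ord ψ

theorem IsMonicReduced.leadExp_mem_support {U : UpperSet (ℕ × ℕ)} {ψ : SmoothGerm}
    (h : IsMonicReduced ord U ψ) : leadExp ord ψ ∈ support ψ :=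
  fun h0 => one_ne_zero (h.1.symm.trans h0)

theorem isMonicReduced_term_one_add {U : UpperSet (ℕ × ℕ)} {α : ℕ × ℕ} {r : SmoothGerm}
    (hlt : ∀ δ ∈ support r, ord.lt δ α) (hU : ∀ δ ∈ support r, δ ∉ U) :
    leadExp ord (term 1 α + r) = α ∧ IsMonicReduced ord U (term 1 α + r) := by
  have mem_support_of_ne {δ} (hδ : δ ∈ support (term 1 α + r)) (hne : δ ≠ α) : δ ∈ support r := by
    simpa [mem_support, taylorCoeff_add, taylorCoeff_term, hne] using hδ
  have coeff_self : taylorCoeff (term 1 α + r) α = 1 := by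
    have hr : taylorCoeff r α = 0 := by_contra fun h => ord.irrefl α (hlt α h)
    simp [taylorCoeff_add, taylorCoeff_term, hr]
  have hlead : leadExp ord (term 1 α + r) = α :=
    leadExp_eq ⟨by simp [mem_support, coeff_self],
      fun δ hδ hne => hlt δ (mem_support_of_ne hδ hne)⟩
  refine ⟨hlead, by rw [leadCoeff, hlead, coeff_self], fun δ hδ hδU => ?_⟩
  by_contra hne
  exact hU δ (mem_support_of_ne hδ (hlead ▸ hne)) hδU

theorem lt_leadExp_of_mem_support_sub {φ : SmoothGerm} {δ : ℕ × ℕ} (hφ : ¬ IsFlat φ)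
    (hδ : δ ∈ support (term (leadCoeff ord φ)⁻¹ 0 * φ - term 1 (leadExp ord φ))) :
    ord.lt δ (leadExp ord φ) := by
  rw [mem_support, taylorCoeff_sub, taylorCoeff_term_zero_mul, taylorCoeff_term] at hδ
  have hne : δ ≠ leadExp ord φ := by
    rintro rfl
    rw [if_pos rfl, ← leadCoeff, inv_mul_cancel₀ (leadCoeff_ne_zero ord hφ), sub_self] at hδ
    exact hδ rfl
  rw [if_neg hne, sub_zero] at hδ
  exact (isMax_support_leadExp ord hφ).2 δ (right_ne_zero_of_mul hδ) hne

theorem exists_isMonicReduced {g : ι → SmoothGerm} {j : ι} (hj : ¬ IsFlat (g j)) :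
    ∃ u ψ, IsUnit u ∧ u * g j - ψ ∈ Ideal.span (g '' {j}ᶜ) ∧
      leadExp ord ψ = leadExp ord (g j) ∧ IsMonicReduced ord (leadUpperSet ord g) ψ := by
  classical
  have := Fintype.ofFinite ι
  let s : Finset ι := {k | ¬ IsFlat (g k)}
  have mem_s {k} : k ∈ s ↔ ¬ IsFlat (g k) := Finset.mem_filter_univ k
  set α := leadExp ord (g j)
  set c := leadCoeff ord (g j)
  set φ := term c⁻¹ 0 * g j - term 1 α with hφ
  obtain ⟨q, hqU, hqlt⟩ := exists_division ord s (fun k => mem_s.1) φ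
  obtain ⟨hq, hr⟩ := hqlt α fun γ => lt_leadExp_of_mem_support_sub hj
  refine ⟨term c⁻¹ 0 - q j, term 1 α + (φ - ∑ k ∈ s, q k * g k), ?_, ?_,
    isMonicReduced_term_one_add hr fun δ hδ ⟨k, hk, hkδ⟩ => hqU k (mem_s.2 hk) δ hkδ hδ⟩
  · have hq0 : taylorCoeff (q j) 0 = 0 := by
      by_contra h
      exact ord.irrefl α (by simpa using hq j (mem_s.2 hj) 0 h)
    refine isUnit_of_taylorCoeff_zero_ne_zero ?_
    rw [taylorCoeff_sub, taylorCoeff_term, if_pos rfl, hq0, sub_zero]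
    exact inv_ne_zero (leadCoeff_ne_zero ord hj)
  · have hsum := Finset.add_sum_erase s (fun k => q k * g k) (mem_s.2 hj)
    have hdiff : (term c⁻¹ 0 - q j) * g j - (term 1 α + (φ - ∑ k ∈ s, q k * g k)) =
        ∑ k ∈ s.erase j, q k * g k := by
      rw [hφ, ← hsum]
      ring
    rw [hdiff]
    exact Ideal.sum_mem _ fun k hk => Ideal.mul_mem_left _ _ <|
      Ideal.subset_span <| Set.mem_image_of_mem g (Finset.ne_of_mem_erase hk)

theorem exists_forall_isMonicReduced (ord : LocalOrder) (g : ι → SmoothGerm) :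
    ∃ g' : ι → SmoothGerm, Ideal.span (Set.range g') = Ideal.span (Set.range g) ∧
      (∀ i, IsFlat (g' i) ↔ IsFlat (g i)) ∧ (∀ i, leadExp ord (g' i) = leadExp ord (g i)) ∧
      ∀ i, ¬ IsFlat (g i) → IsMonicReduced ord (leadUpperSet ord g) (g' i) := by
  classical
  have := Fintype.ofFinite ι
  suffices key : ∀ s : Finset ι, ∃ g' : ι → SmoothGerm,
      Ideal.span (Set.range g') = Ideal.span (Set.range g) ∧
      (∀ i, IsFlat (g' i) ↔ IsFlat (g i)) ∧ (∀ i, leadExp ord (g' i) = leadExp ord (g i)) ∧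
      ∀ i ∈ s, ¬ IsFlat (g i) → IsMonicReduced ord (leadUpperSet ord g) (g' i) by
    simpa using key Finset.univ
  intro s
  induction s using Finset.induction_on with
  | empty => exact ⟨g, rfl, fun _ => Iff.rfl, fun _ => rfl, by simp⟩
  | insert j s _ ih =>
    obtain ⟨h, hspan, hflat, hlead, hred⟩ := ih
    by_cases hj : IsFlat (g j)
    · refine ⟨h, hspan, hflat, hlead, fun i hi hi0 => hred i ?_ hi0⟩
      exact (Finset.mem_insert.1 hi).resolve_left fun hij => hi0 (hij ▸ hj)
    have hU : leadUpperSet ord h = leadUpperSet ord g := by simp only [leadUpperSet, hflat, hlead]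
    obtain ⟨u, ψ, hu, hmem, hψlead, hψ⟩ := exists_isMonicReduced (ord := ord) ((hflat j).not.2 hj)
    have hψ0 : ¬ IsFlat ψ := not_isFlat_of_mem_support hψ.leadExp_mem_support
    refine ⟨Function.update h j ψ, (span_range_update_eq hu hmem).trans hspan, fun i => ?_,
      fun i => ?_, fun i hi hi0 => ?_⟩ <;> rcases eq_or_ne i j with rfl | hij
    · simp [hψ0, hj]
    · simp [hij, hflat]
    · simp [hψlead, hlead]
    · simp [hij, hlead]
    · simpa [hU] using hψ
    · simpa [hij] using hred i ((Finset.mem_insert.1 hi).resolve_left hij) hi0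

theorem exists_monic_leadTermsDivideNoTerms (ord : LocalOrder) {n : ℕ} (f : Fin n → SmoothGerm) :
    ∃ g : Fin n → SmoothGerm, Ideal.span (Set.range g) = Ideal.span (Set.range f) ∧
      leadUpperSet ord g ≤ leadUpperSet ord f ∧ (∀ i, ¬ IsFlat (g i) → leadCoeff ord (g i) = 1) ∧
      LeadTermsDivideNoTerms ord g := by
  obtain ⟨g, hspan, hU, hantichain⟩ := exists_pairwise_not_leadExp_le ord f
  obtain ⟨h, hspan', hflat, hlead, hred⟩ := exists_forall_isMonicReduced ord g
  have hU' : leadUpperSet ord h = leadUpperSet ord g := by simp only [leadUpperSet, hflat, hlead]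
  simp only [← hflat, ← hlead, ← hU'] at hantichain hred
  refine ⟨h, hspan'.trans hspan, hU'.le.trans hU, fun i hi => (hred i hi).1, ?_⟩
  rintro i j _ ⟨δ, hδ, rfl⟩ hne hdvd
  obtain ⟨hi, hle⟩ := (leadTerm_dvd_term_iff ord hδ).1 hdvd
  have hj := not_isFlat_of_mem_support hδ
  obtain rfl := (hred j hj).2 δ hδ ⟨i, hi, hle⟩
  by_cases hij : i = j
  · exact hne ⟨hij, hij ▸ rfl⟩
  · exact hantichain i j hij hi hj hle

theorem IsStandardBasis.of_leadUpperSet_le {n m : ℕ} {f : Fin n → SmoothGerm}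
    {g : Fin m → SmoothGerm} {I : Ideal SmoothGerm} (hf : IsStandardBasis ord f I)
    (hg : Ideal.span (Set.range g) = I) (h : leadUpperSet ord g ≤ leadUpperSet ord f) :
    IsStandardBasis ord g I := by
  refine ⟨hg, le_antisymm ?_ ?_⟩
  · rw [hf.2, Ideal.span_le]
    rintro _ ⟨i, rfl⟩
    by_cases hi : IsFlat (f i)
    · simp [leadTerm_of_isFlat ord hi]
    · obtain ⟨k, hk⟩ := h ⟨i, hi, le_rfl⟩
      exact Ideal.mem_of_dvd _ ((leadTerm_dvd_term_iff ord (leadCoeff_ne_zero ord hi)).2 hk)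
        (Ideal.subset_span ⟨k, rfl⟩)
  · refine Ideal.span_mono ?_
    rintro _ ⟨i, rfl⟩
    exact ⟨g i, hg ▸ Ideal.subset_span ⟨i, rfl⟩, rfl⟩

theorem IsReducedStandardBasis.comp_succAbove {m : ℕ} {g : Fin (m + 1) → SmoothGerm}
    {I : Ideal SmoothGerm} (hg : IsReducedStandardBasis ord g I) {j : Fin (m + 1)}
    (hj : IsFlat (g j)) (hmem : g j ∈ Ideal.span (g '' {j}ᶜ)) :
    IsReducedStandardBasis ord (g ∘ j.succAbove) I := by
  obtain ⟨hbasis, hmonic, hdiv⟩ := hg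
  refine ⟨hbasis.of_leadUpperSet_le ?_ ?_, fun i => hmonic _, fun i k p hp hne => ?_⟩
  · rw [← hbasis.1, Set.range_comp, Fin.range_succAbove, range_eq_insert_image_compl g j]
    exact (Submodule.span_insert_eq_span hmem).symm
  · rintro δ ⟨i, hi, hle⟩
    obtain ⟨k, rfl⟩ := Fin.exists_succAbove_eq (x := i) (y := j) fun hij => hi (hij ▸ hj)
    exact ⟨k, hi, hle⟩
  · exact hdiv _ _ p hp fun h => hne ⟨Fin.succAbove_right_injective h.1, h.2⟩

theorem IsReducedStandardBasis.exists_flat_irredundant {m : ℕ} {g : Fin m → SmoothGerm}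
    {I : Ideal SmoothGerm} (hg : IsReducedStandardBasis ord g I) :
    ∃ k ≤ m, ∃ h : Fin k → SmoothGerm, IsReducedStandardBasis ord h I ∧
      ∀ j, IsFlat (h j) → h j ∉ Ideal.span (h '' {i | i ≠ j}) := by
  induction m with
  | zero => exact ⟨0, le_rfl, g, hg, fun j => j.elim0⟩
  | succ m ih =>
    by_cases hredundant : ∃ j, IsFlat (g j) ∧ g j ∈ Ideal.span (g '' {i | i ≠ j})
    · obtain ⟨j, hj, hmem⟩ := hredundant
      obtain ⟨k, hk, hh⟩ := ih (hg.comp_succAbove hj hmem)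
      exact ⟨k, hk.trans m.le_succ, hh⟩
    · push Not at hredundant
      exact ⟨m + 1, le_rfl, g, hg, hredundant⟩

end SmoothGerm

theorem mainTheorem6 (ord : LocalOrder) (n : ℕ) (f : Fin n → SmoothGerm)
    (I : Ideal SmoothGerm) (hI : I = Ideal.span (Set.range f)) :
    (∃ m ≤ n, ∃ g : Fin m → SmoothGerm,
      I = Ideal.span (Set.range g) ∧ SmoothGerm.LeadTermsDivideNoTerms ord g) ∧
    (SmoothGerm.IsStandardBasis ord f I →
      ∃ m ≤ n, ∃ g : Fin m → SmoothGerm,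
        SmoothGerm.IsReducedStandardBasis ord g I ∧
        ∀ j, SmoothGerm.IsFlat (g j) → g j ∉ Ideal.span (g '' {i | i ≠ j})) := by
  obtain ⟨g, hspan, hU, hmonic, hdiv⟩ := SmoothGerm.exists_monic_leadTermsDivideNoTerms ord f
  refine ⟨⟨n, le_rfl, g, hI.trans hspan.symm, hdiv⟩, fun hf => ?_⟩
  have hg : SmoothGerm.IsReducedStandardBasis ord g I :=
    ⟨hf.of_leadUpperSet_le (hspan.trans hI.symm) hU, hmonic, hdiv⟩
  exact hg.exists_flat_irredundant
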